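/- Let $k\ge 1$ be an integer. An oscillating tableau of length $n$ is a sequence $\emptyset=\lambda^0,\lambda^1,\dots,\lambda^n$ of Ferrers diagrams in which each $\lambda^{i}$ ($1\le i\le n$) is obtained from $\lambda^{i-1}$ by adding or deleting exactly one box; its height is bounded by $k$ if every $\lambda^i$ has at most $k$ rows, and it ends in a row shape if $\lambda^n=(m)$ for some $m\ge 0$, where $(0)=\emptyset$. Let $o_k(n)$ be the number of oscillating tableaux of length $n$ and height bounded by $k$ that end in a row shape, and let \[ \tilde O_k(t)=\sum_{n\ge 0} o_k(n)\,\frac{t^n}{n!}. \] For $j\in\mathbb Z$ let \[ b_j(t)=I_j(2t)=\sum_{a\ge \max(0,-j)}\frac{t^{2a+j}}{a!\,(a+j)!}, \] where $I_j$ is the hyperbolic (modified) Bessel function of the first kind of order $j$. Then, as formal power series in $t$, \[ \tilde O_k(t)=\sum_{u=0}^{k-1}(-1)^u\left(\sum_{\ell=u}^{2k-1-u} b_\ell(t)\right)\det\bigl(b_{i-j}(t)-b_{2k-i-j}(t)\bigr)_{0\le i\le k-1,\ i\ne u;\ 1\le j\le k-1}, \] where the indices $i$ and $j$ of the $(k-1)\times(k-1)$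 determinant are taken in increasing order, and the empty determinant (for $k=1$) equals $1$. -/

import Mathlib

/-- `ν` is obtained from `μ` by adding one box. -/
def AddsBox (μ ν : YoungDiagram) : Prop :=
  μ ≤ ν ∧ ν.card = μ.card + 1

/-- The number of rows of a Ferrers diagram. -/
def diagramHeight (μ : YoungDiagram) : ℕ :=
  μ.colLen 0

/-- `μ` is a row shape `(m)` for some `m ≥ 0`; the case `m = 0` is the empty shape. -/
def IsRowShape (μ : YoungDiagram) : Prop :=
  ∃ m : ℕ, ∀ c : ℕ × ℕ, c ∈ μ ↔ c.1 = 0 ∧ c.2 < m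

/-- A sequence `T 0, …, T n` of Ferrers diagrams is an oscillating tableau of length `n`: it starts
at the empty shape, and at each of the `n` steps one box is either added or deleted. -/
def IsOscillatingTableau {n : ℕ} (T : Fin (n + 1) → YoungDiagram) : Prop :=
  T 0 = ⊥ ∧ ∀ i : Fin n, AddsBox (T i.castSucc) (T i.succ) ∨ AddsBox (T i.succ) (T i.castSucc)

/-- Oscillating tableaux of length `n`, of height bounded by `k`, ending in a row shape. -/
def rowOscillatingTableaux (k n : ℕ) : Set (Fin (n + 1) → YoungDiagram) :=
  {T | IsOscillatingTableau T ∧ (∀ i, diagramHeight (T i) ≤ k) ∧ IsRowShape (T (Fin.last n))}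

/-- The exponential generating function, by length, of oscillating tableaux of height bounded by
`k` that end in a row shape. -/
noncomputable def rowOscillatingEGF (k : ℕ) : PowerSeries ℚ :=
  PowerSeries.mk fun n => ((rowOscillatingTableaux k n).ncard : ℚ) / (n.factorial : ℚ)

/-- The power series of the hyperbolic (modified) Bessel function of the first kind of integer
order `j`, `I_j(x) = ∑_a (x/2)^(2a+j) / (a! (a+j)!)`, the sum being over all `a ≥ 0` with
`a + j ≥ 0`. The coefficient of `x^p` collects the pairs `(a, a + j)` with sum `p`. -/
noncomputable def besselI (j : ℤ) : PowerSeries ℚ :=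
  PowerSeries.mk fun p => ∑ q ∈ Finset.HasAntidiagonal.antidiagonal p,
    if (q.2 : ℤ) = (q.1 : ℤ) + j then
      (1 / 2 : ℚ) ^ p / ((q.1.factorial : ℚ) * (q.2.factorial : ℚ))
    else 0

/-- The series `b_j(t) = I_j(2t)`. -/
noncomputable def besselB (j : ℤ) : PowerSeries ℚ :=
  PowerSeries.rescale (2 : ℚ) (besselI j)

/-- The `r`-th element, counted from `0`, of `ℕ \ {u}` in increasing order. -/
def skipIndex (u r : ℕ) : ℕ :=
  if r < u then r else r + 1

/-- The matrix `(b_{i-j} - b_{2k-i-j})` with `i` running through `{0, …, k-1} \ {u}` and `j` through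
`{1, …, k-1}`, both in increasing order. -/
noncomputable def rowMinor (k u : ℕ) : Matrix (Fin (k - 1)) (Fin (k - 1)) (PowerSeries ℚ) :=
  Matrix.of fun r c =>
    let i : ℤ := (skipIndex u (r : ℕ) : ℤ)
    let j : ℤ := ((c : ℕ) : ℤ) + 1
    besselB (i - j) - besselB (2 * (k : ℤ) - i - j)

/-! ### The series `besselB` -/

/-! Adding (k, k-1, …, 1) to the row lengths turns tableaux of height at most k into unit-step
lattice walks from p = (k, …, 1) inside the chamber x_0 > … > x_{k-1} > 0. The walks to x have
exponential generating function D(x) = det(b_{p_i - x_j} - b_{p_i + x_j}). Instead of a reflection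
argument, both sides are shown to satisfy the same recursion (`ncard_tableauxEndingAt`): b_j' =
b_{j-1} + b_{j+1} makes D(x)' the sum of D over the 2k neighbours of x, D vanishes at neighbours
outside the chamber, and D(x) has constant term 1 at x = p and 0 at other chamber points. On the
counting side, the last step is removed.

For the row shape (m) only the first column depends on m. Expanding along it gives entries b_{u+m} -
b_{2k-u+m} with cofactors free of m, and summing over m telescopes to b_u + … + b_{2k-1-u}. Since
X^m divides D at (m), the infinite sum over m is handled modulo X^(n+1), one coefficient at a time.
-/

theorem coeff_besselB (j : ℤ) (p : ℕ) :
    PowerSeries.coeff p (besselB j) = ∑ q ∈ Finset.HasAntidiagonal.antidiagonal p,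
      if (q.2 : ℤ) = (q.1 : ℤ) + j then
        1 / ((q.1.factorial : ℚ) * (q.2.factorial : ℚ)) else 0 := by
  rw [besselB, PowerSeries.coeff_rescale, besselI, PowerSeries.coeff_mk, Finset.mul_sum]
  refine Finset.sum_congr rfl fun q _ => ?_
  split_ifs
  · rw [← mul_div_assoc, ← mul_pow]
    norm_num
  · simp

theorem besselB_neg (j : ℤ) : besselB (-j) = besselB j := by
  ext p
  rw [coeff_besselB, coeff_besselB, ← Finset.Nat.sum_antidiagonal_swap]
  refine Finset.sum_congr rfl fun q _ => ?_
  have h : ((q.swap.2 : ℤ) = (q.swap.1 : ℤ) + -j) ↔ ((q.2 : ℤ) = (q.1 : ℤ) + j) := by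
    simp only [Prod.fst_swap, Prod.snd_swap]
    omega
  rw [if_congr h rfl rfl, Prod.fst_swap, Prod.snd_swap, mul_comm (q.2.factorial : ℚ)]

theorem coeff_besselB_eq_zero {j : ℤ} {p : ℕ} (h : (p : ℤ) < j) :
    PowerSeries.coeff p (besselB j) = 0 := by
  rw [coeff_besselB]
  refine Finset.sum_eq_zero fun q hq => if_neg ?_
  rw [Finset.HasAntidiagonal.mem_antidiagonal] at hq
  omega

theorem X_pow_dvd_besselB {j : ℤ} {n : ℕ} (h : (n : ℤ) ≤ j) :
    (PowerSeries.X : PowerSeries ℚ) ^ n ∣ besselB j :=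
  PowerSeries.X_pow_dvd_iff.2 fun _ hm => coeff_besselB_eq_zero (by omega)

theorem constantCoeff_besselB (j : ℤ) :
    PowerSeries.constantCoeff (besselB j) = if j = 0 then 1 else 0 := by
  rw [← PowerSeries.coeff_zero_eq_constantCoeff_apply, coeff_besselB]
  simp [eq_comm]

theorem derivative_besselB (j : ℤ) :
    PowerSeries.derivative ℚ (besselB j) = besselB (j - 1) + besselB (j + 1) := by
  ext p
  rw [PowerSeries.coeff_derivative, map_add, coeff_besselB, coeff_besselB, coeff_besselB]
  let g : ℕ × ℕ → ℚ := fun q =>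
    if (q.2 : ℤ) = (q.1 : ℤ) + j then 1 / ((q.1.factorial : ℚ) * (q.2.factorial : ℚ)) else 0
  have split : (∑ q ∈ Finset.HasAntidiagonal.antidiagonal (p + 1), g q) * (p + 1 : ℚ) =
      ∑ q ∈ Finset.HasAntidiagonal.antidiagonal (p + 1), g q * q.2 +
        ∑ q ∈ Finset.HasAntidiagonal.antidiagonal (p + 1), g q * q.1 := by
    rw [Finset.sum_mul, ← Finset.sum_add_distrib]
    refine Finset.sum_congr rfl fun q hq => ?_
    rw [Finset.HasAntidiagonal.mem_antidiagonal] at hq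
    rw [← mul_add]
    -- The factor p + 1 is the sum of the two antidiagonal indices; each summand then cancels one
    -- factorial.
    congr 1
    exact_mod_cast (by omega : p + 1 = q.2 + q.1)
  refine split.trans ?_
  rw [Finset.Nat.sum_antidiagonal_succ' (f := fun q => g q * (q.2 : ℚ)),
    Finset.Nat.sum_antidiagonal_succ (f := fun q => g q * (q.1 : ℚ))]
  simp only [Nat.cast_zero, mul_zero, zero_add]
  congr 1
  · refine Finset.sum_congr rfl fun q _ => ?_
    have h : (((q.2 + 1 : ℕ) : ℤ) = (q.1 : ℤ) + j) ↔ ((q.2 : ℤ) = (q.1 : ℤ) + (j - 1)) := by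
      omega
    simp only [g, h]
    split_ifs
    · rw [Nat.factorial_succ]
      push_cast
      have := Nat.cast_add_one_ne_zero (R := ℚ) q.2
      field_simp
    · simp
  · refine Finset.sum_congr rfl fun q _ => ?_
    have h : ((q.2 : ℤ) = ((q.1 + 1 : ℕ) : ℤ) + j) ↔ ((q.2 : ℤ) = (q.1 : ℤ) + (j + 1)) := by
      omega
    simp only [g, h]
    split_ifs
    · rw [Nat.factorial_succ]
      push_cast
      have := Nat.cast_add_one_ne_zero (R := ℚ) q.1
      field_simp
    · simp

/-! ### Derivations and determinants -/

theorem Derivation.map_prod_eq_sum {R A ι : Type*} [CommRing R] [CommRing A] [Algebra R A]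
    [DecidableEq ι] (D : Derivation R A A) (s : Finset ι) (f : ι → A) :
    D (∏ i ∈ s, f i) = ∑ j ∈ s, ∏ i ∈ s, Function.update f j (D (f j)) i := by
  induction s using Finset.induction_on with
  | empty => simp
  | insert a s ha ih =>
    rw [Finset.prod_insert ha, D.leibniz, Finset.sum_insert ha, Finset.prod_insert ha, ih,
      smul_eq_mul, smul_eq_mul, Function.update_self, add_comm, Finset.mul_sum]
    congr 1
    · rw [mul_comm]
      congr 1
      refine Finset.prod_congr rfl fun i hi => ?_
      rw [Function.update_of_ne (by rintro rfl; exact ha hi)]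
    · refine Finset.sum_congr rfl fun j hj => ?_
      rw [Finset.prod_insert ha, Function.update_of_ne (by rintro rfl; exact ha hj)]

theorem Derivation.map_det {R A ι : Type*} [CommRing R] [CommRing A] [Algebra R A]
    [DecidableEq ι] [Fintype ι] (D : Derivation R A A) (M : Matrix ι ι A) :
    D M.det = ∑ j, (M.updateCol j fun i => D (M i j)).det := by
  simp only [Matrix.det_apply, map_sum]
  rw [Finset.sum_comm]
  refine Finset.sum_congr rfl fun σ _ => ?_
  rw [← Finset.smul_sum, Units.smul_def, Units.smul_def, map_zsmul, D.map_prod_eq_sum]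
  congr 1
  refine Finset.sum_congr rfl fun j _ => Finset.prod_congr rfl fun i _ => ?_
  by_cases h : i = j
  · subst h
    simp
  · simp [h]

/-! ### The determinant counting walks in the Weyl chamber of type `C` -/

/-- The position `(k, k - 1, …, 1)` of the empty diagram. -/
def basePoint (k : ℕ) (i : Fin k) : ℤ := (k : ℤ) - (i : ℕ)

/-- The matrix whose determinant is the exponential generating function, by length, of lattice
walks from `basePoint k` to `x` in the open Weyl chamber of type `C`. -/
noncomputable def walkMatrix (k : ℕ) (x : Fin k → ℤ) : Matrix (Fin k) (Fin k) (PowerSeries ℚ) :=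
  Matrix.of fun i j => besselB (basePoint k i - x j) - besselB (basePoint k i + x j)

/-- The lattice points with `x 0 > x 1 > … > x (k - 1) > 0`. -/
def IsChamber {k : ℕ} (x : Fin k → ℤ) : Prop :=
  StrictAnti x ∧ ∀ i, 0 < x i

theorem walkMatrix_update {k : ℕ} (x : Fin k → ℤ) (j : Fin k) (a : ℤ) :
    walkMatrix k (Function.update x j a) = (walkMatrix k x).updateCol j
      fun i => besselB (basePoint k i - a) - besselB (basePoint k i + a) := by
  ext1 i l
  by_cases h : l = j
  · subst h
    simp [walkMatrix]
  · simp [walkMatrix, h]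

/-- Differentiating column j gives the sum of the columns for x_j + 1 and x_j - 1: the two shifts of
p_i - x_j and of p_i + x_j pair up in opposite order. -/
theorem derivative_det_walkMatrix {k : ℕ} (x : Fin k → ℤ) :
    PowerSeries.derivative ℚ (walkMatrix k x).det =
      ∑ j, ((walkMatrix k (Function.update x j (x j + 1))).det +
        (walkMatrix k (Function.update x j (x j - 1))).det) := by
  rw [Derivation.map_det]
  refine Finset.sum_congr rfl fun j _ => ?_
  rw [walkMatrix_update, walkMatrix_update, ← Matrix.det_updateCol_add]
  congr 2
  funext i
  simp only [walkMatrix, Matrix.of_apply, map_sub, derivative_besselB, Pi.add_apply]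
  rw [show basePoint k i - x j - 1 = basePoint k i - (x j + 1) by ring,
    show basePoint k i - x j + 1 = basePoint k i - (x j - 1) by ring,
    show basePoint k i + x j - 1 = basePoint k i + (x j - 1) by ring,
    show basePoint k i + x j + 1 = basePoint k i + (x j + 1) by ring]
  ring

theorem det_walkMatrix_eq_zero_of_eq {k : ℕ} {x : Fin k → ℤ} {i j : Fin k} (hij : i ≠ j)
    (h : x i = x j) : (walkMatrix k x).det = 0 :=
  Matrix.det_zero_of_column_eq hij fun l => by simp [walkMatrix, h]

theorem det_walkMatrix_eq_zero_of_zero {k : ℕ} {x : Fin k → ℤ} {i : Fin k}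
    (h : x i = 0) : (walkMatrix k x).det = 0 :=
  Matrix.det_eq_zero_of_column_eq_zero i fun l => by simp [walkMatrix, h]

/-- The walk determinant vanishes at the neighbours of a chamber point that leave the chamber. -/
theorem det_walkMatrix_update_eq_zero {k : ℕ} {x : Fin k → ℤ} (hx : IsChamber x) (j : Fin k)
    {e : ℤ} (he : e = 1 ∨ e = -1) (h : ¬ IsChamber (Function.update x j (x j + e))) :
    (walkMatrix k (Function.update x j (x j + e))).det = 0 := by
  by_contra hdet
  -- A unit step can break a strict integer inequality only by producing an equality, that is, two
  -- equal columns or a zero column.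
  have hinj : ∀ i, i ≠ j → x i ≠ x j + e := fun i hij hi =>
    hdet (det_walkMatrix_eq_zero_of_eq hij (by simp [hij, hi]))
  have hpos : x j + e ≠ 0 := fun h0 =>
    hdet (det_walkMatrix_eq_zero_of_zero (i := j) (by simp [h0]))
  refine h ⟨fun a b hab => ?_, fun i => ?_⟩
  · have hlt := hx.1 hab
    by_cases ha : a = j
    · subst ha
      have hb : b ≠ a := hab.ne'
      have := hinj b hb
      simp only [Function.update_self, Function.update_of_ne hb]
      omega
    · have := hinj a ha
      by_cases hb : b = j
      · subst hb
        simp only [Function.update_self, Function.update_of_ne ha]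
        omega
      · simpa only [Function.update_of_ne ha, Function.update_of_ne hb]
  · have := hx.2 i
    by_cases hi : i = j
    · subst hi
      simp only [Function.update_self]
      omega
    · simpa only [Function.update_of_ne hi]

theorem isChamber_basePoint (k : ℕ) : IsChamber (basePoint k) := by
  refine ⟨fun a b hab => ?_, fun i => ?_⟩
  · have : (a : ℕ) < b := hab
    simp only [basePoint]
    omega
  · have := i.2
    simp only [basePoint]
    omega

theorem IsChamber.add_le {k : ℕ} {x : Fin k → ℤ} (hx : IsChamber x) {a b : Fin k} (hab : a ≤ b) :
    x b + ((b : ℕ) - (a : ℕ) : ℤ) ≤ x a := by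
  obtain ⟨a, ha⟩ := a
  obtain ⟨b, hb⟩ := b
  replace hab : a ≤ b := hab
  induction b, hab using Nat.le_induction with
  | base => simp
  | succ b hab ih =>
    have h1 := ih (by omega)
    have h2 := hx.1 (show (⟨b, by omega⟩ : Fin k) < ⟨b + 1, hb⟩ from Nat.lt_succ_self b)
    simp only at h1 ⊢
    push_cast at h1 ⊢
    omega

theorem IsChamber.basePoint_le {k : ℕ} {x : Fin k → ℤ} (hx : IsChamber x) (i : Fin k) :
    basePoint k i ≤ x i := by
  have hi := i.2
  have h := hx.add_le (a := i) (b := ⟨k - 1, by omega⟩) (Fin.mk_le_mk.2 (by omega))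
  have := hx.2 ⟨k - 1, by omega⟩
  simp only [basePoint] at h ⊢
  omega

theorem constantCoeff_det_walkMatrix {k : ℕ} {x : Fin k → ℤ} (hx : IsChamber x) :
    PowerSeries.constantCoeff (walkMatrix k x).det = if x = basePoint k then 1 else 0 := by
  have entry : ∀ i j, PowerSeries.constantCoeff (walkMatrix k x i j) =
      if basePoint k i = x j then 1 else 0 := fun i j => by
    have h1 := (isChamber_basePoint k).2 i
    have h2 := hx.2 j
    simp only [walkMatrix, Matrix.of_apply, map_sub, constantCoeff_besselB, sub_eq_zero]
    rw [if_neg (by omega : ¬ basePoint k i + x j = 0), sub_zero]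
  rw [RingHom.map_det]
  split_ifs with h
  · convert Matrix.det_one (n := Fin k) (R := ℚ)
    ext i j
    rw [RingHom.mapMatrix_apply, Matrix.map_apply, entry, h, Matrix.one_apply]
    simp only [(isChamber_basePoint k).1.injective.eq_iff]
  · have hk : 0 < k := by
      rcases k with _ | k
      · exact absurd (Subsingleton.elim _ _) h
      · omega
    -- If x_0 equalled some p_i ≤ k, strict decrease would force x ≤ p, hence x = p because p is the
    -- least chamber point.
    refine Matrix.det_eq_zero_of_column_eq_zero ⟨0, hk⟩ fun i => ?_
    rw [RingHom.mapMatrix_apply, Matrix.map_apply, entry, if_neg]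
    intro h0
    refine h (funext fun l => le_antisymm ?_ (hx.basePoint_le l))
    have := hx.add_le (a := ⟨0, hk⟩) (b := l) (Fin.mk_le_mk.2 (by omega))
    simp only [basePoint] at h0 this ⊢
    push_cast at this
    omega

/-! ### Diagrams as chamber points -/

/-- The point `(λ₁ + k, λ₂ + k - 1, …, λₖ + 1)` attached to a diagram `λ`. -/
def diagramPoint (k : ℕ) (μ : YoungDiagram) (i : Fin k) : ℤ :=
  (μ.rowLen i : ℤ) + basePoint k i

theorem diagramHeight_le_iff {k : ℕ} {μ : YoungDiagram} :
    diagramHeight μ ≤ k ↔ ∀ i, k ≤ i → μ.rowLen i = 0 := by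
  have key : ∀ i, i < diagramHeight μ ↔ 0 < μ.rowLen i := fun i => by
    rw [diagramHeight, ← YoungDiagram.mem_iff_lt_colLen, YoungDiagram.mem_iff_lt_rowLen]
  constructor
  · intro h i hi
    have := key i
    omega
  · intro h
    by_contra hlt
    have h1 := (key k).1 (by omega)
    have h2 := h k le_rfl
    omega

theorem isChamber_diagramPoint (k : ℕ) (μ : YoungDiagram) : IsChamber (diagramPoint k μ) := by
  refine ⟨fun a b hab => ?_, fun i => ?_⟩
  · have h1 := (isChamber_basePoint k).1 hab
    have h2 := μ.rowLen_anti a b (le_of_lt hab)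
    simp only [diagramPoint]
    omega
  · have := (isChamber_basePoint k).2 i
    simp only [diagramPoint]
    omega

theorem YoungDiagram.le_iff_rowLen_le {μ ν : YoungDiagram} :
    μ ≤ ν ↔ ∀ i, μ.rowLen i ≤ ν.rowLen i := by
  constructor
  · intro h i
    by_contra hlt
    have h1 : (i, ν.rowLen i) ∈ μ := YoungDiagram.mem_iff_lt_rowLen.2 (by omega)
    have h2 : (i, ν.rowLen i) ∈ ν := h h1
    exact lt_irrefl _ (YoungDiagram.mem_iff_lt_rowLen.1 h2)
  · rintro h ⟨i, j⟩ hc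
    exact YoungDiagram.mem_iff_lt_rowLen.2
      ((YoungDiagram.mem_iff_lt_rowLen.1 hc).trans_le (h i))

theorem le_iff_diagramPoint_le {k : ℕ} {μ ν : YoungDiagram} (hμ : diagramHeight μ ≤ k) :
    μ ≤ ν ↔ ∀ i, diagramPoint k μ i ≤ diagramPoint k ν i := by
  rw [YoungDiagram.le_iff_rowLen_le]
  constructor
  · intro h i
    have := h i
    simp only [diagramPoint]
    omega
  · intro h i
    by_cases hi : i < k
    · have := h ⟨i, hi⟩
      simp only [diagramPoint] at this
      omega
    · rw [diagramHeight_le_iff.1 hμ i (by omega)]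
      exact Nat.zero_le _

theorem diagramPoint_inj {k : ℕ} {μ ν : YoungDiagram} (hμ : diagramHeight μ ≤ k)
    (hν : diagramHeight ν ≤ k) : diagramPoint k μ = diagramPoint k ν ↔ μ = ν := by
  refine ⟨fun h => le_antisymm ?_ ?_, fun h => h ▸ rfl⟩
  · rw [le_iff_diagramPoint_le hμ, h]
    exact fun _ => le_rfl
  · rw [le_iff_diagramPoint_le hν, h]
    exact fun _ => le_rfl

/-- Row i receives x_i - p_i boxes, which is nonnegative and weakly decreasing in i. With
`diagramPoint_inj` this identifies diagrams of height at most k with chamber points. -/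
theorem exists_diagramPoint_eq {k : ℕ} {x : Fin k → ℤ} (hx : IsChamber x) :
    ∃ μ, diagramHeight μ ≤ k ∧ diagramPoint k μ = x := by
  let μ : YoungDiagram :=
    { cells := (Finset.univ : Finset (Fin k)).biUnion fun i =>
        (Finset.range (x i - basePoint k i).toNat).image fun j => ((i : ℕ), j)
      isLowerSet := by
        rintro ⟨i, j⟩ ⟨i', j'⟩ hle hmem
        simp only [Finset.coe_biUnion, Finset.coe_univ, Set.mem_univ, Set.iUnion_true,
          Finset.coe_image, Finset.coe_range, Set.mem_iUnion, Set.mem_image, Set.mem_Iio,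
          Prod.mk.injEq] at hmem ⊢
        obtain ⟨a, b, hb, rfl, rfl⟩ := hmem
        have h1 : i' ≤ a := hle.1
        have h2 : j' ≤ b := hle.2
        have h3 := a.2
        refine ⟨⟨i', by omega⟩, j', ?_, rfl, rfl⟩
        have h4 := hx.add_le (a := ⟨i', by omega⟩) (b := a) h1
        simp only [basePoint] at hb h4 ⊢
        omega }
  have hmem : ∀ i j, (i, j) ∈ μ ↔ ∃ a : Fin k, j < (x a - basePoint k a).toNat ∧ (a : ℕ) = i := by
    intro i j
    simp [μ, ← YoungDiagram.mem_cells]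
  have hrow : ∀ i : Fin k, μ.rowLen i = (x i - basePoint k i).toNat := by
    intro i
    refine eq_of_forall_lt_iff fun j => ?_
    rw [← YoungDiagram.mem_iff_lt_rowLen, hmem]
    constructor
    · rintro ⟨a, ha, hai⟩
      rwa [← Fin.ext hai]
    · exact fun h => ⟨i, h, rfl⟩
  refine ⟨μ, diagramHeight_le_iff.2 fun i hi => ?_, funext fun i => ?_⟩
  · by_contra h0
    obtain ⟨a, -, ha⟩ :=
      (hmem i 0).1 (YoungDiagram.mem_iff_lt_rowLen.2 (Nat.pos_of_ne_zero h0))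
    have := a.2
    omega
  · have := hx.basePoint_le i
    rw [diagramPoint, hrow]
    omega

theorem card_eq_sum_rowLen {k : ℕ} {μ : YoungDiagram} (hμ : diagramHeight μ ≤ k) :
    μ.card = ∑ i : Fin k, μ.rowLen i := by
  rw [Fin.sum_univ_eq_sum_range fun i => μ.rowLen i]
  simp only [YoungDiagram.rowLen_eq_card, YoungDiagram.row]
  refine Finset.card_eq_sum_card_fiberwise fun c hc => ?_
  have hc' : (c.1, c.2) ∈ μ := hc
  rw [YoungDiagram.mem_iff_lt_rowLen] at hc'
  by_contra hk
  have := diagramHeight_le_iff.1 hμ c.1 (by simpa using hk)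
  omega

/-- Nonnegative integer differences with sum 1 have exactly one nonzero entry, equal to 1. -/
theorem addsBox_iff {k : ℕ} {μ ν : YoungDiagram} (hμ : diagramHeight μ ≤ k)
    (hν : diagramHeight ν ≤ k) :
    AddsBox μ ν ↔ ∃ j, diagramPoint k ν =
      Function.update (diagramPoint k μ) j (diagramPoint k μ j + 1) := by
  have hcard : ν.card = μ.card + 1 ↔
      ∑ i, (diagramPoint k ν i - diagramPoint k μ i) = 1 := by
    rw [card_eq_sum_rowLen hμ, card_eq_sum_rowLen hν]
    simp only [diagramPoint, add_sub_add_right_eq_sub, Finset.sum_sub_distrib]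
    rw [← Nat.cast_sum, ← Nat.cast_sum]
    omega
  rw [AddsBox, le_iff_diagramPoint_le hμ, hcard]
  constructor
  · rintro ⟨hle, hsum⟩
    have hnn : ∀ i ∈ Finset.univ, 0 ≤ diagramPoint k ν i - diagramPoint k μ i :=
      fun i _ => sub_nonneg.2 (hle i)
    obtain ⟨j, hj⟩ : ∃ j, diagramPoint k μ j < diagramPoint k ν j := by
      by_contra! hall
      have : ∑ i, (diagramPoint k ν i - diagramPoint k μ i) ≤ 0 :=
        Finset.sum_nonpos fun i _ => sub_nonpos.2 (hall i)
      omega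
    refine ⟨j, funext fun i => ?_⟩
    rw [← Finset.add_sum_erase _ _ (Finset.mem_univ j)] at hsum
    have hnn' : ∀ i ∈ Finset.univ.erase j, 0 ≤ diagramPoint k ν i - diagramPoint k μ i :=
      fun i _ => hnn i (Finset.mem_univ i)
    have hrest := Finset.sum_nonneg hnn'
    by_cases hi : i = j
    · subst hi
      rw [Function.update_self]
      omega
    · rw [Function.update_of_ne hi]
      have := Finset.single_le_sum hnn' (Finset.mem_erase.2 ⟨hi, Finset.mem_univ i⟩)
      have := hle i
      omega
  · rintro ⟨j, hj⟩
    have hdiff : ∀ i, diagramPoint k ν i - diagramPoint k μ i = if i = j then 1 else 0 := by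
      intro i
      rw [hj]
      by_cases hi : i = j
      · subst hi
        simp
      · simp [hi]
    refine ⟨fun i => ?_, ?_⟩
    · have := hdiff i
      split_ifs at this <;> omega
    · simp [hdiff]

/-! ### Oscillating tableaux as walks -/

/-- The neighbour of `x` in direction `s.1`, up if `s.2` and down otherwise. -/
def latticeStep {k : ℕ} (x : Fin k → ℤ) (s : Fin k × Bool) : Fin k → ℤ :=
  Function.update x s.1 (x s.1 + bif s.2 then 1 else -1)

theorem latticeStep_injective {k : ℕ} (x : Fin k → ℤ) : Function.Injective (latticeStep x) := by
  rintro ⟨a, b⟩ ⟨c, d⟩ h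
  have h1 := congrFun h a
  by_cases hac : a = c
  · subst hac
    cases b <;> cases d <;> simp [latticeStep] at h1 ⊢
  · cases b <;> simp [latticeStep, hac] at h1

theorem addsBox_or_addsBox_iff {k : ℕ} {μ ν : YoungDiagram} (hμ : diagramHeight μ ≤ k)
    (hν : diagramHeight ν ≤ k) :
    AddsBox μ ν ∨ AddsBox ν μ ↔ ∃ s, diagramPoint k μ = latticeStep (diagramPoint k ν) s := by
  have flip : ∀ (x y : Fin k → ℤ) (j : Fin k),
      y = Function.update x j (x j + 1) ↔ x = Function.update y j (y j + -1) := by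
    intro x y j
    constructor <;> rintro rfl <;> simp
  rw [addsBox_iff hμ hν, addsBox_iff hν hμ]
  constructor
  · rintro (⟨j, hj⟩ | ⟨j, hj⟩)
    · exact ⟨(j, false), (flip _ _ _).1 hj⟩
    · exact ⟨(j, true), hj⟩
  · rintro ⟨⟨j, _ | _⟩, hj⟩
    · exact Or.inl ⟨j, (flip _ _ _).2 hj⟩
    · exact Or.inr ⟨j, hj⟩

/-- Oscillating tableaux of length `n` and height bounded by `k` whose last shape has position
`x`. -/
def tableauxEndingAt (k n : ℕ) (x : Fin k → ℤ) : Set (Fin (n + 1) → YoungDiagram) :=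
  {T | IsOscillatingTableau T ∧ (∀ i, diagramHeight (T i) ≤ k) ∧
    diagramPoint k (T (Fin.last n)) = x}

theorem tableauxEndingAt_eq_empty {k n : ℕ} {x : Fin k → ℤ} (hx : ¬ IsChamber x) :
    tableauxEndingAt k n x = ∅ :=
  Set.eq_empty_of_forall_notMem fun _ hT => hx (hT.2.2 ▸ isChamber_diagramPoint _ _)

theorem disjoint_tableauxEndingAt {k n : ℕ} {x y : Fin k → ℤ} (hxy : x ≠ y) :
    Disjoint (tableauxEndingAt k n x) (tableauxEndingAt k n y) :=
  Set.disjoint_left.2 fun _ h1 h2 => hxy (h1.2.2.symm.trans h2.2.2)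

theorem diagramHeight_bot_le (k : ℕ) : diagramHeight ⊥ ≤ k := by
  refine diagramHeight_le_iff.2 fun i _ => ?_
  by_contra h
  exact YoungDiagram.notMem_bot _ (YoungDiagram.mem_iff_lt_rowLen.2 (Nat.pos_of_ne_zero h))

theorem diagramPoint_bot (k : ℕ) : diagramPoint k ⊥ = basePoint k := by
  funext i
  have := diagramHeight_le_iff.1 (diagramHeight_bot_le 0) i (Nat.zero_le _)
  simp [diagramPoint, this]

theorem tableauxEndingAt_zero (k : ℕ) (x : Fin k → ℤ) :
    tableauxEndingAt k 0 x = if x = basePoint k then {fun _ => ⊥} else ∅ := by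
  have hsub : ∀ i : Fin (0 + 1), i = 0 := fun i => Fin.ext (by omega)
  ext T
  have hT : T = (fun _ => ⊥) ↔ T 0 = ⊥ :=
    ⟨fun h => h ▸ rfl, fun h => funext fun i => by rw [hsub i, h]⟩
  split_ifs with h
  · rw [Set.mem_singleton_iff, hT]
    refine ⟨fun hT => hT.1.1, fun h0 => ⟨⟨h0, fun i => i.elim0⟩, fun i => ?_, ?_⟩⟩
    · rw [hsub i, h0]
      exact diagramHeight_bot_le k
    · rw [hsub (Fin.last 0), h0, h, diagramPoint_bot]
  · refine iff_of_false (fun hT => h ?_) (Set.notMem_empty _)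
    rw [← hT.2.2, hsub (Fin.last 0), hT.1.1, diagramPoint_bot]

theorem tableauxEndingAt_succ {k : ℕ} (n : ℕ) {ν : YoungDiagram} (hν : diagramHeight ν ≤ k) :
    tableauxEndingAt k (n + 1) (diagramPoint k ν) =
      ⋃ s, (fun T : Fin (n + 1) → YoungDiagram =>
        (Fin.snoc T ν : Fin (n + 2) → YoungDiagram)) ''
          tableauxEndingAt k n (latticeStep (diagramPoint k ν) s) := by
  ext T
  rw [Set.mem_iUnion]
  constructor
  · rintro ⟨⟨h0, hstep⟩, hht, hlast⟩
    rw [diagramPoint_inj (hht _) hν] at hlast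
    have hl := hstep (Fin.last n)
    rw [Fin.succ_last, hlast, addsBox_or_addsBox_iff (hht _) hν] at hl
    obtain ⟨s, hs⟩ := hl
    refine ⟨s, Fin.init T, ⟨⟨h0, fun i => ?_⟩, fun i => hht _, hs⟩, ?_⟩
    · exact hstep i.castSucc
    · simp only [← hlast]
      exact Fin.snoc_init_self T
  · rintro ⟨s, T, ⟨⟨h0, hstep⟩, hht, hlast⟩, rfl⟩
    refine ⟨⟨?_, fun i => ?_⟩, fun i => ?_, ?_⟩
    · exact (Fin.snoc_castSucc (α := fun _ => YoungDiagram) ν T 0).trans h0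
    · refine Fin.lastCases ?_ (fun i => ?_) i
      · simp only [Fin.succ_last, Fin.snoc_castSucc, Fin.snoc_last]
        exact (addsBox_or_addsBox_iff (hht _) hν).2 ⟨s, hlast⟩
      · simp only [← Fin.castSucc_succ, Fin.snoc_castSucc]
        exact hstep i
    · refine Fin.lastCases ?_ (fun i => ?_) i
      · simpa only [Fin.snoc_last] using hν
      · simpa only [Fin.snoc_castSucc] using hht i
    · simp only [Fin.snoc_last]

theorem finite_tableauxEndingAt (k n : ℕ) (x : Fin k → ℤ) : (tableauxEndingAt k n x).Finite := by
  induction n generalizing x with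
  | zero =>
    rw [tableauxEndingAt_zero]
    split_ifs
    · exact Set.finite_singleton _
    · exact Set.finite_empty
  | succ n ih =>
    by_cases hx : IsChamber x
    · obtain ⟨ν, hν, rfl⟩ := exists_diagramPoint_eq hx
      rw [tableauxEndingAt_succ n hν]
      exact Set.finite_iUnion fun s => (ih _).image _
    · rw [tableauxEndingAt_eq_empty hx]
      exact Set.finite_empty

theorem ncard_tableauxEndingAt_succ {k : ℕ} (n : ℕ) {x : Fin k → ℤ} (hx : IsChamber x) :
    (tableauxEndingAt k (n + 1) x).ncard =
      ∑ s, (tableauxEndingAt k n (latticeStep x s)).ncard := by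
  obtain ⟨ν, hν, rfl⟩ := exists_diagramPoint_eq hx
  have hinj : Function.Injective fun T : Fin (n + 1) → YoungDiagram =>
      (Fin.snoc T ν : Fin (n + 2) → YoungDiagram) :=
    Fin.snoc_left_injective (α := fun _ => YoungDiagram) ν
  rw [tableauxEndingAt_succ n hν, Set.ncard_iUnion_of_finite
    (fun s => (finite_tableauxEndingAt _ _ _).image _), finsum_eq_sum_of_fintype]
  · exact Finset.sum_congr rfl fun s _ => Set.ncard_image_of_injective _ hinj
  · intro s s' hss
    exact (Set.disjoint_image_iff hinj).2
      (disjoint_tableauxEndingAt ((latticeStep_injective _).ne hss))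

theorem ncard_tableauxEndingAt {k : ℕ} (n : ℕ) {x : Fin k → ℤ} (hx : IsChamber x) :
    ((tableauxEndingAt k n x).ncard : ℚ) =
      n.factorial * PowerSeries.coeff n (walkMatrix k x).det := by
  induction n generalizing x with
  | zero =>
    rw [PowerSeries.coeff_zero_eq_constantCoeff_apply, constantCoeff_det_walkMatrix hx,
      tableauxEndingAt_zero]
    split_ifs <;> simp
  | succ n ih =>
    have step : ∀ s, ((tableauxEndingAt k n (latticeStep x s)).ncard : ℚ) =
        n.factorial * PowerSeries.coeff n (walkMatrix k (latticeStep x s)).det := by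
      intro s
      by_cases hs : IsChamber (latticeStep x s)
      · exact ih hs
      · rw [tableauxEndingAt_eq_empty hs, latticeStep,
          det_walkMatrix_update_eq_zero hx s.1 (by cases s.2 <;> simp) hs]
        simp
    have hder := congrArg (PowerSeries.coeff n) (derivative_det_walkMatrix x)
    rw [PowerSeries.coeff_derivative, map_sum] at hder
    rw [ncard_tableauxEndingAt_succ n hx, Nat.cast_sum, Finset.sum_congr rfl fun s _ => step s,
      ← Finset.mul_sum, Fintype.sum_prod_type, Nat.factorial_succ, Nat.cast_mul,
      mul_comm ((n + 1 : ℕ) : ℚ), mul_assoc, mul_comm ((n + 1 : ℕ) : ℚ), Nat.cast_add_one, hder]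
    simp [latticeStep, sub_eq_add_neg]

/-! ### Row shapes -/

/-- The position of the row shape `(m)`. -/
def rowPoint (k m : ℕ) : Fin (k + 1) → ℤ :=
  Function.update (basePoint (k + 1)) 0 ((k : ℤ) + 1 + m)

theorem rowPoint_injective (k : ℕ) : Function.Injective (rowPoint k) := by
  intro m m' h
  have := congrFun h 0
  simp only [rowPoint, Function.update_self] at this
  omega

theorem isRowShape_iff {k : ℕ} {μ : YoungDiagram} (hμ : diagramHeight μ ≤ k + 1) :
    IsRowShape μ ↔ ∃ m, diagramPoint (k + 1) μ = rowPoint k m := by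
  have hrow : ∀ m, diagramPoint (k + 1) μ = rowPoint k m ↔
      μ.rowLen 0 = m ∧ ∀ i, i ≠ 0 → μ.rowLen i = 0 := by
    intro m
    constructor
    · intro h
      refine ⟨?_, fun i hi => ?_⟩
      · have := congrFun h 0
        simp only [diagramPoint, rowPoint, Function.update_self, basePoint, Fin.val_zero] at this
        omega
      · by_cases hik : i < k + 1
        · have := congrFun h ⟨i, hik⟩
          rw [rowPoint, Function.update_of_ne (fun h0 => hi (congrArg Fin.val h0)),
            diagramPoint] at this
          simpa using this
        · exact diagramHeight_le_iff.1 hμ i (by omega)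
    · rintro ⟨h0, h⟩
      funext i
      by_cases hi : i = 0
      · subst hi
        simp only [diagramPoint, rowPoint, Function.update_self, basePoint, Fin.val_zero, h0]
        push_cast
        ring
      · rw [rowPoint, Function.update_of_ne hi, diagramPoint, h i (fun h0 => hi (Fin.ext h0))]
        simp
  refine exists_congr fun m => (Iff.trans ?_ (hrow m).symm)
  constructor
  · intro h
    have hlt : ∀ i j, j < μ.rowLen i ↔ i = 0 ∧ j < m := fun i j =>
      YoungDiagram.mem_iff_lt_rowLen.symm.trans (h (i, j))
    refine ⟨eq_of_forall_lt_iff fun j => by simp [hlt], fun i hi => ?_⟩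
    by_contra h0
    exact hi ((hlt i 0).1 (Nat.pos_of_ne_zero h0)).1
  · rintro ⟨h0, h⟩ ⟨i, j⟩
    rw [YoungDiagram.mem_iff_lt_rowLen]
    by_cases hi : i = 0
    · simp [hi, h0]
    · simp [hi, h i hi]

theorem isChamber_rowPoint (k m : ℕ) : IsChamber (rowPoint k m) := by
  have hb := isChamber_basePoint (k + 1)
  have h0 : basePoint (k + 1) 0 ≤ (k : ℤ) + 1 + m := by
    simp [basePoint]
  refine ⟨fun a b hab => ?_, fun i => ?_⟩
  · have hb0 : b ≠ 0 := ((Fin.zero_le a).trans_lt hab).ne'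
    have hlt := hb.1 hab
    rw [rowPoint, Function.update_of_ne hb0]
    by_cases ha : a = 0
    · subst ha
      rw [Function.update_self]
      omega
    · rwa [Function.update_of_ne ha]
  · have := hb.2 i
    by_cases hi : i = 0
    · subst hi
      rw [rowPoint, Function.update_self]
      omega
    · rwa [rowPoint, Function.update_of_ne hi]

theorem walkMatrix_rowPoint_zero (k m : ℕ) (i : Fin (k + 1)) :
    walkMatrix (k + 1) (rowPoint k m) i 0 =
      besselB (((i : ℕ) + m : ℕ) : ℤ) - besselB ((2 * (k + 1) - i + m : ℕ) : ℤ) := by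
  have hi := i.2
  rw [walkMatrix, Matrix.of_apply, rowPoint, Function.update_self, ← besselB_neg]
  congr 2
  · simp only [basePoint]
    push_cast
    ring
  · simp only [basePoint]
    omega

theorem submatrix_walkMatrix_rowPoint (k m : ℕ) (u : Fin (k + 1)) :
    (walkMatrix (k + 1) (rowPoint k m)).submatrix u.succAbove Fin.succ = rowMinor (k + 1) u := by
  ext1 r c
  have hr : (u.succAbove r : ℕ) = skipIndex u r := by
    simp only [Fin.succAbove, skipIndex, Fin.lt_def, Fin.val_castSucc]
    split_ifs <;> simp
  simp only [Matrix.submatrix_apply, walkMatrix, Matrix.of_apply, rowPoint, rowMinor,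
    Function.update_of_ne (Fin.succ_ne_zero c), basePoint, hr, Fin.val_succ]
  rw [← besselB_neg]
  congr 2
  · push_cast
    ring
  · push_cast
    ring

/-- The generating function of walks to the row shape `(m)`, expanded along the first column. -/
theorem det_walkMatrix_rowPoint (k m : ℕ) :
    (walkMatrix (k + 1) (rowPoint k m)).det =
      ∑ u : Fin (k + 1), (-1) ^ (u : ℕ) *
        (besselB (((u : ℕ) + m : ℕ) : ℤ) - besselB ((2 * (k + 1) - u + m : ℕ) : ℤ)) *
          (rowMinor (k + 1) u).det := by
  rw [Matrix.det_succ_column_zero]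
  exact Finset.sum_congr rfl fun u _ => by
    rw [walkMatrix_rowPoint_zero, submatrix_walkMatrix_rowPoint]

theorem X_pow_dvd_det_walkMatrix_rowPoint (k m : ℕ) :
    (PowerSeries.X : PowerSeries ℚ) ^ m ∣ (walkMatrix (k + 1) (rowPoint k m)).det := by
  rw [det_walkMatrix_rowPoint]
  refine Finset.dvd_sum fun u _ => Dvd.dvd.mul_right (Dvd.dvd.mul_left (dvd_sub ?_ ?_) _) _
  · exact X_pow_dvd_besselB (by omega)
  · exact X_pow_dvd_besselB (by omega)

theorem rowOscillatingTableaux_eq_iUnion (k n : ℕ) :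
    rowOscillatingTableaux (k + 1) n =
      ⋃ m : Fin (n + 1), tableauxEndingAt (k + 1) n (rowPoint k m) := by
  ext T
  rw [Set.mem_iUnion]
  constructor
  · rintro ⟨hT, hht, hrow⟩
    obtain ⟨m, hm⟩ := (isRowShape_iff (hht _)).1 hrow
    have hmem : T ∈ tableauxEndingAt (k + 1) n (rowPoint k m) := ⟨hT, hht, hm⟩
    have hmn : m < n + 1 := by
      by_contra hlt
      have hcard := ncard_tableauxEndingAt n (isChamber_rowPoint k m)
      -- A row longer than n is unreachable in n steps: its count is a coefficient below the order
      -- of the determinant.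
      rw [PowerSeries.X_pow_dvd_iff.1 (X_pow_dvd_det_walkMatrix_rowPoint k m) n (by omega),
        mul_zero, Nat.cast_eq_zero, Set.ncard_eq_zero (finite_tableauxEndingAt _ _ _)] at hcard
      rw [hcard] at hmem
      exact hmem
    exact ⟨⟨m, hmn⟩, hmem⟩
  · rintro ⟨m, hT, hht, hm⟩
    exact ⟨hT, hht, (isRowShape_iff (hht _)).2 ⟨m, hm⟩⟩

theorem coeff_rowOscillatingEGF (k n : ℕ) :
    PowerSeries.coeff n (rowOscillatingEGF (k + 1)) =
      PowerSeries.coeff n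
        (∑ m ∈ Finset.range (n + 1), (walkMatrix (k + 1) (rowPoint k m)).det) := by
  rw [rowOscillatingEGF, PowerSeries.coeff_mk, rowOscillatingTableaux_eq_iUnion,
    Set.ncard_iUnion_of_finite (fun m => finite_tableauxEndingAt _ _ _), finsum_eq_sum_of_fintype,
    Nat.cast_sum, Finset.sum_congr rfl fun m _ => ncard_tableauxEndingAt n (isChamber_rowPoint k _),
    ← Finset.mul_sum, mul_div_cancel_left₀ _ (Nat.cast_ne_zero.2 n.factorial_ne_zero), map_sum,
    ← Fin.sum_univ_eq_sum_range fun m =>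
      PowerSeries.coeff n (walkMatrix (k + 1) (rowPoint k m)).det]
  intro m m' hmm
  exact disjoint_tableauxEndingAt ((rowPoint_injective k).ne (Fin.val_injective.ne hmm))

/-- Telescoping with gap d: the sum of g over `range (N + d)` is split once after N terms and once
after d. -/
theorem sum_range_sub_shift {A : Type*} [AddCommGroup A] (g : ℕ → A) (N d : ℕ) :
    ∑ m ∈ Finset.range N, (g m - g (d + m)) =
      ∑ l ∈ Finset.range d, g l - ∑ l ∈ Finset.range d, g (N + l) := by
  have h := (Finset.sum_range_add g N d).symm.trans
    ((congrArg (fun a => ∑ l ∈ Finset.range a, g l) (add_comm N d)).trans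
      (Finset.sum_range_add g d N))
  rw [Finset.sum_sub_distrib, sub_eq_sub_iff_add_eq_add]
  exact h

theorem X_pow_dvd_sum_besselB_sub {k u : ℕ} (hu : u < k + 1) (n : ℕ) :
    (PowerSeries.X : PowerSeries ℚ) ^ (n + 1) ∣
      ∑ m ∈ Finset.range (n + 1),
        (besselB ((u + m : ℕ) : ℤ) - besselB ((2 * (k + 1) - u + m : ℕ) : ℤ)) -
      ∑ l ∈ Finset.Icc u (2 * (k + 1) - 1 - u), besselB (l : ℤ) := by
  have hIcc : Finset.Icc u (2 * (k + 1) - 1 - u) = Finset.Ico u (2 * (k + 1) - u) := by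
    ext l
    rw [Finset.mem_Icc, Finset.mem_Ico]
    omega
  have hd : ∀ m, 2 * (k + 1) - u + m = u + (2 * (k + 1) - u - u + m) := fun m => by omega
  rw [hIcc, Finset.sum_Ico_eq_sum_range]
  simp only [hd]
  rw [sum_range_sub_shift fun m => besselB ((u + m : ℕ) : ℤ), sub_sub_cancel_left, dvd_neg]
  -- What remains of the telescoping is the tail, whose Bessel orders are all at least n + 1.
  exact Finset.dvd_sum fun l _ => X_pow_dvd_besselB (by omega)

theorem mainTheorem5 (k : ℕ) (hk : 1 ≤ k) :
    rowOscillatingEGF k =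
      ∑ u ∈ Finset.range k,
        (-1 : PowerSeries ℚ) ^ u * (∑ l ∈ Finset.Icc u (2 * k - 1 - u), besselB (l : ℤ)) *
          (rowMinor k u).det := by
  obtain ⟨k, rfl⟩ := Nat.exists_eq_add_of_le' hk
  ext n
  rw [coeff_rowOscillatingEGF, ← sub_eq_zero, ← map_sub]
  -- Coefficient n needs only a congruence modulo X^(n+1), which matches the truncation m ≤ n.
  refine PowerSeries.X_pow_dvd_iff.1 ?_ n (Nat.lt_succ_self n)
  simp only [det_walkMatrix_rowPoint]
  rw [Finset.sum_comm, ← Fin.sum_univ_eq_sum_range fun u => (-1 : PowerSeries ℚ) ^ u *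
    (∑ l ∈ Finset.Icc u (2 * (k + 1) - 1 - u), besselB (l : ℤ)) * (rowMinor (k + 1) u).det,
    ← Finset.sum_sub_distrib]
  refine Finset.dvd_sum fun u _ => ?_
  rw [← Finset.sum_mul, ← Finset.mul_sum, ← sub_mul, ← mul_sub]
  exact Dvd.dvd.mul_right (Dvd.dvd.mul_left (X_pow_dvd_sum_besselB_sub u.2 n) _) _
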